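/- Conventions. For a cardinal $\theta$, $H(\theta)$ is the set of all sets whose transitive closure has cardinality less than $\theta$, and $\mathcal P_\kappa X$ is the set of subsets of $X$ of cardinality less than $\kappa$. A set $C\subseteq\mathcal P_\kappa X$ is \emph{cofinal} if every $x\in\mathcal P_\kappa X$ is contained in some $y\in C$; it is a \emph{strong club} if it is cofinal and $\bigcup D\in C$ for every nonempty $D\subseteq C$ with $|D|<\kappa$. A subset of $\mathcal P_\kappa X$ is \emph{weakly stationary} if it meets every strong club in $\mathcal P_\kappa X$. Let $\mu\le\kappa\le\theta$ be uncountable cardinals with $\kappa,\theta$ regular. For $M\subseteq H(\theta)$ and $x\in M$, a set $d\subseteq x$ is \emph{$(\mu,M)$-approximated} if for every $z\in M\cap\mathcal P_\mu(x)$ there is $e\in M$ with $d\cap z=e\cap z$; and $d$ is \emph{$N$-guessed} if there is $e\in N$ with $d\cap N=e\cap N$. For $S\subseteq\mathcal P_\kappa H(\theta)$, the pair $(M,x)$ is \emph{almost $\mu$-guessed by $S$} if $x\in M$ and for every $(\mu,M)$-approximated $d\subseteq x$ there is $N\in S$ such that $x\in N\subseteq M$ and $d$ is $N$-guessed. For $\mathcal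 Y\subseteq\mathcal P_\kappa H(\theta)$, $\mathsf{wAGP}_{\mathcal Y}(\mu,\kappa,\theta)$ asserts that for every cofinal $S\subseteq\mathcal P_\kappa H(\theta)$ and every $x\in H(\theta)$, the set of $M\in\mathcal Y$ such that $(M,x)$ is almost $\mu$-guessed by $S$ is weakly stationary in $\mathcal P_\kappa H(\theta)$. A function $c:[\lambda]^2\to\chi$ is \emph{subadditive} if for all $\alpha<\beta<\gamma<\lambda$ both $c(\alpha,\gamma)\le\max\{c(\alpha,\beta),c(\beta,\gamma)\}$ and $c(\alpha,\beta)\le\max\{c(\alpha,\gamma),c(\beta,\gamma)\}$; it is \emph{strongly unbounded} if $c``[A]^2$ is unbounded in $\chi$ for every unbounded $A\subseteq\lambda$. For a regular uncountable cardinal $\lambda$, $\square(\lambda)$ asserts that there is a sequence $\langle C_\alpha\mid\alpha<\lambda\text{ limit}\rangle$ such that each $C_\alpha$ is club in $\alpha$; $C_\beta=C_\alpha\cap\beta$ whenever $\beta<\alpha$ is a limit point of $C_\alpha$; and there is no club $D\subseteq\lambda$ with $D\cap\alpha=C_\alpha$ for every limit point $\alpha<\lambda$ of $D$. Theorem. Let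 $\chi<\chi^+<\kappa\le\lambda$ be infinite cardinals with $\kappa$ regular and $\operatorname{cf}(\lambda)\ge\kappa$, let \[\mathcal Y:=\{M\in\mathcal P_\kappa H(\lambda^+)\mid \operatorname{cf}(\sup(M\cap\lambda))>\chi\},\] and suppose that $\mathsf{wAGP}_{\mathcal Y}(\kappa,\kappa,\lambda^+)$ holds. Then there is no subadditive, strongly unbounded function $c:[\lambda]^2\to\chi$. Moreover, if $\lambda$ is regular, then $\square(\lambda)$ fails. -/

import Mathlib

open Cardinal Ordinal Order Set

universe u

/-! ### `H(θ)`, `𝒫_κ X` and strong clubs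

The set-theoretic universe is `ZFSet.{u}`; a collection of subsets of `X` is a
`Set ZFSet.{u}`. -/

/-- `H(θ)`: the sets whose transitive closure has cardinality less than `θ`, equivalently the
sets contained in some transitive set of cardinality less than `θ`. -/
def hereditary (θ : Cardinal.{u}) : Set ZFSet.{u} :=
  {x | ∃ t : ZFSet.{u}, t.IsTransitive ∧ x ⊆ t ∧ t.card < θ}

/-- `𝒫_κ X`: the subsets of `X` of cardinality less than `κ`. -/
def smallSubsets (κ : Cardinal.{u}) (X : Set ZFSet.{u}) : Set ZFSet.{u} :=
  {M | (∀ y ∈ M, y ∈ X) ∧ M.card < κ}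

/-- `S` is a cofinal subset of `𝒫_κ X`. -/
def CofinalIn (κ : Cardinal.{u}) (X : Set ZFSet.{u}) (S : Set ZFSet.{u}) : Prop :=
  S ⊆ smallSubsets κ X ∧ ∀ M ∈ smallSubsets κ X, ∃ N ∈ S, M ⊆ N

/-- `C` is a strong club in `𝒫_κ X`: a cofinal subset closed under unions of arbitrary (not
necessarily linearly ordered) nonempty subcollections of cardinality less than `κ`. -/
def IsStrongClub (κ : Cardinal.{u}) (X : Set ZFSet.{u}) (C : Set ZFSet.{u}) : Prop :=
  CofinalIn κ X C ∧
    ∀ D : ZFSet.{u}, D.Nonempty → (∀ M ∈ D, M ∈ C) → D.card < κ → ZFSet.sUnion D ∈ C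

/-- `A` is a weakly stationary subset of `𝒫_κ X`: it meets every strong club. -/
def IsWeaklyStationary (κ : Cardinal.{u}) (X : Set ZFSet.{u}) (A : Set ZFSet.{u}) : Prop :=
  A ⊆ smallSubsets κ X ∧ ∀ C : Set ZFSet.{u}, IsStrongClub κ X C → (A ∩ C).Nonempty

/-! ### The weak almost guessing property -/

/-- The subset `d` of `x` is `(μ, M)`-approximated: every `z ∈ M ∩ 𝒫_μ(x)` admits `e ∈ M` with
`d ∩ z = e ∩ z`. -/
def IsApproximated (μ : Cardinal.{u}) (M x d : ZFSet.{u}) : Prop :=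
  ∀ z ∈ M, z ⊆ x → z.card < μ → ∃ e ∈ M, d ∩ z = e ∩ z

/-- `d` is `N`-guessed. -/
def IsGuessed (N d : ZFSet.{u}) : Prop :=
  ∃ e ∈ N, d ∩ N = e ∩ N

/-- `(M, x)` is almost `μ`-guessed by `S`. -/
def IsAlmostGuessed (μ : Cardinal.{u}) (S : Set ZFSet.{u}) (M x : ZFSet.{u}) : Prop :=
  x ∈ M ∧ ∀ d : ZFSet.{u}, d ⊆ x → IsApproximated μ M x d →
    ∃ N ∈ S, x ∈ N ∧ N ⊆ M ∧ IsGuessed N d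

/-- `wAGP_Y(μ, κ, θ)`. -/
def WAGP (Y : Set ZFSet.{u}) (μ κ θ : Cardinal.{u}) : Prop :=
  ∀ S : Set ZFSet.{u}, CofinalIn κ (hereditary θ) S → ∀ x ∈ hereditary θ,
    IsWeaklyStationary κ (hereditary θ)
      {M | M ∈ smallSubsets κ (hereditary θ) ∧ M ∈ Y ∧ IsAlmostGuessed μ S M x}

/-- `sup (M ∩ lam)`, where ordinals are identified with von Neumann ordinals. -/
noncomputable def supBelow (M : ZFSet.{u}) (lam : Cardinal.{u}) : Ordinal.{u} :=
  sSup {α : Ordinal.{u} | α < lam.ord ∧ α.toZFSet ∈ M}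

/-- The set of `M ∈ 𝒫_κ H(lam⁺)` with `cf (sup (M ∩ lam)) > χ`. -/
def largeCofinality (χ κ lam : Cardinal.{u}) : Set ZFSet.{u} :=
  {M | M ∈ smallSubsets κ (hereditary (succ lam)) ∧ χ < (supBelow M lam).cof}

/-! ### Subadditive functions -/

/-- `[o]²`, as the set of pairs `α < β < o`. -/
abbrev OrdPairs (o : Ordinal.{u}) : Type (u + 1) :=
  {p : Iio o × Iio o // p.1 < p.2}

/-- The two triangle inequalities for `c : [lam]² → χ`. -/
def IsSubadditive {lam χ : Cardinal.{u}} (c : OrdPairs lam.ord → Iio χ.ord) : Prop :=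
  ∀ (α β γ : Iio lam.ord) (h₁ : α < β) (h₂ : β < γ),
    c ⟨(α, γ), h₁.trans h₂⟩ ≤ max (c ⟨(α, β), h₁⟩) (c ⟨(β, γ), h₂⟩) ∧
    c ⟨(α, β), h₁⟩ ≤ max (c ⟨(α, γ), h₁.trans h₂⟩) (c ⟨(β, γ), h₂⟩)

/-- For every unbounded `A ⊆ lam`, the image of `[A]²` under `c` is unbounded in `χ`. -/
def IsStronglyUnbounded {lam χ : Cardinal.{u}} (c : OrdPairs lam.ord → Iio χ.ord) : Prop :=
  ∀ A : Set (Iio lam.ord), ¬ BddAbove A →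
    ¬ BddAbove (c '' {p | p.1.1 ∈ A ∧ p.1.2 ∈ A})

/-! ### The square principle -/

/-- The limit points of `A`: the nonzero `β` with `A ∩ β` unbounded in `β`. -/
def limitPoints (A : Set Ordinal.{u}) : Set Ordinal.{u} :=
  {β | β ≠ 0 ∧ ∀ γ < β, ∃ δ ∈ A, γ < δ ∧ δ < β}

/-- `A` is a closed unbounded subset of the ordinal `α`. -/
def IsClubIn (A : Set Ordinal.{u}) (α : Ordinal.{u}) : Prop :=
  A ⊆ Iio α ∧ (∀ γ < α, ∃ δ ∈ A, γ < δ) ∧ ∀ β < α, β ∈ limitPoints A → β ∈ A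

/-- `□(lam)`: there is a coherent sequence of clubs `C α ⊆ α`, for limit `α < lam`, with no
thread. The values of `C` at other ordinals are irrelevant. -/
def SquarePrinciple (lam : Cardinal.{u}) : Prop :=
  ∃ C : Ordinal.{u} → Set Ordinal.{u},
    (∀ α < lam.ord, IsSuccLimit α → IsClubIn (C α) α) ∧
    (∀ α < lam.ord, IsSuccLimit α → ∀ β < α, β ∈ limitPoints (C α) → C β = C α ∩ Iio β) ∧
    ¬ ∃ D : Set Ordinal.{u}, IsClubIn D lam.ord ∧
      ∀ α < lam.ord, α ∈ limitPoints D → C α = D ∩ Iio α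

/-!
Given a subadditive `c : [lam]² → χ`, take a sufficiently closed `M` in the set provided by
`wAGP`, let `δ = sup (M ∩ lam)`, and let `d` be the set of codes of the pairs `(j, α)` with
`i ≤ j` and `c(α, δ) ≤ j`. As `cf δ > χ`, some `i` satisfies `c(β, δ) ≤ i` for cofinally many
`β ∈ M ∩ δ`; for such `β`, subadditivity makes `c(·, δ)` and `c(·, β)` agree below `β` about being
at most `j ≥ i`, so `d` is `(κ, M)`-approximated. An `e ∈ N` guessing `d`, where `N ⊆ M`, codes
for each level `j ≥ i` a set `A_j` such that `α ∈ A_j ↔ c(α, δ) ≤ j` for `α ∈ N ∩ lam`. If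
`N ∩ lam` is `χ⁺`-directed, then some `s ∈ N ∩ lam` lies above bounds, chosen in `N`, of all the
bounded `A_j`. Since `s ∈ A_j` for some `j`, that `A_j` is unbounded, so by strong unboundedness it
contains a pair of color greater than `j`, which can be found in `N`. But pairs in `A_j ∩ N` have
color at most `j` by subadditivity.

For `□(lam)`, the absence of a thread yields weights `h : lam → ω` that are constant along the
limit points of each `C_α` and take every value on sets meeting all clubs; Todorčević's function
`ρ` computed from the walks along `C` with these weights is subadditive and strongly unbounded.
-/

universe v

/-! ### Clubs and stationary sets of ordinals -/

theorem exists_forall_lt_of_mk_lt_cof {s : Set Ordinal.{u}} {o : Ordinal.{u}}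
    (hs : #s < (Ordinal.lift.{u + 1} o).cof) (hso : s ⊆ Iio o) : ∃ b < o, ∀ a ∈ s, a < b := by
  refine ⟨_, sSup_add_one_lt_of_lt_cof hs hso, fun a ha => ?_⟩
  refine (lt_add_one a).trans_le (le_csSup ⟨o, ?_⟩ ⟨a, ha, rfl⟩)
  rintro _ ⟨b, hb, rfl⟩
  exact Order.add_one_le_of_lt (hso hb)

section LimitPoints

variable {A B : Set Ordinal.{u}} {β γ : Ordinal.{u}}

theorem isSuccLimit_of_mem_limitPoints (h : β ∈ limitPoints A) : IsSuccLimit β := by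
  refine ⟨by simpa using h.1, fun γ hγ => ?_⟩
  obtain ⟨δ, -, h1, h2⟩ := h.2 γ hγ.lt
  exact hγ.2 h1 h2

theorem limitPoints_mono (h : A ⊆ B) : limitPoints A ⊆ limitPoints B :=
  fun _ hβ => ⟨hβ.1, fun γ hγ => let ⟨δ, hδ, h'⟩ := hβ.2 γ hγ; ⟨δ, h hδ, h'⟩⟩

theorem exists_mem_lt_of_mem_limitPoints (h : β ∈ limitPoints A) : ∃ δ ∈ A, δ < β :=
  let ⟨δ, hδ, _, hδβ⟩ := h.2 0 (pos_iff_ne_zero.2 h.1)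
  ⟨δ, hδ, hδβ⟩

theorem mem_limitPoints_inter_Iio (h : β ≤ γ) :
    β ∈ limitPoints (A ∩ Iio γ) ↔ β ∈ limitPoints A :=
  ⟨fun hβ => limitPoints_mono inter_subset_left hβ, fun hβ => ⟨hβ.1, fun ζ hζ =>
    let ⟨δ, hδ, h1, h2⟩ := hβ.2 ζ hζ; ⟨δ, ⟨hδ, h2.trans_le h⟩, h1, h2⟩⟩⟩

theorem sSup_mem_limitPoints {L : Set Ordinal.{u}} (hL : L ⊆ limitPoints A) (hne : L.Nonempty)
    (hbdd : BddAbove L) : sSup L ∈ limitPoints A := by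
  obtain ⟨μ, hμ⟩ := hne
  refine ⟨((pos_iff_ne_zero.2 (hL hμ).1).trans_le (le_csSup hbdd hμ)).ne', fun γ hγ => ?_⟩
  obtain ⟨ν, hν, hγν⟩ := exists_lt_of_lt_csSup ⟨μ, hμ⟩ hγ
  obtain ⟨δ, hδ, h1, h2⟩ := (hL hν).2 γ hγν
  exact ⟨δ, hδ, h1, h2.trans_le (le_csSup hbdd hν)⟩

theorem exists_mem_limitPoints_of_infinite (hA : A.Infinite) {α : Ordinal.{u}}
    (hα : A ⊆ Iio α) : ∃ μ ∈ limitPoints A, μ ≤ α := by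
  have hαmem : (A ∩ Iio α).Infinite := by rwa [inter_eq_left.2 hα]
  set μ := sInf {s : Ordinal.{u} | (A ∩ Iio s).Infinite}
  have hμ : (A ∩ Iio μ).Infinite :=
    csInf_mem (s := {s : Ordinal.{u} | (A ∩ Iio s).Infinite}) ⟨α, hαmem⟩
  obtain ⟨ξ, hξ⟩ := hμ.nonempty
  refine ⟨μ, ⟨(pos_of_gt hξ.2).ne', fun γ hγ => ?_⟩, csInf_le' hαmem⟩
  by_contra! hgap
  have hfin : (A ∩ Iio γ).Finite := not_infinite.1 fun h => (csInf_le' h).not_gt hγ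
  refine hμ ((hfin.insert γ).subset fun δ hδ => ?_)
  rcases lt_trichotomy δ γ with h | h | h
  · exact Or.inr ⟨hδ.1, h⟩
  · exact Or.inl h
  · exact absurd hδ.2 (not_lt.2 (hgap δ hδ.1 h))

end LimitPoints

/-- `S` is stationary in `o`: it meets every club of `o`. -/
def IsStationaryIn (S : Set Ordinal.{u}) (o : Ordinal.{u}) : Prop :=
  ∀ ⦃D : Set Ordinal.{u}⦄, IsClubIn D o → (S ∩ D).Nonempty

theorem IsClubIn.inter_Ioi {D : Set Ordinal.{u}} {o γ : Ordinal.{u}} (hD : IsClubIn D o)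
    (hγ : γ < o) : IsClubIn (D ∩ Ioi γ) o := by
  refine ⟨inter_subset_left.trans hD.1, fun ξ hξ => ?_, fun β hβ hlim => ?_⟩
  · obtain ⟨δ, hδ, hlt⟩ := hD.2.1 _ (max_lt hξ hγ)
    exact ⟨δ, ⟨hδ, (le_max_right _ _).trans_lt hlt⟩, (le_max_left _ _).trans_lt hlt⟩
  · obtain ⟨δ, hδ, hδβ⟩ := exists_mem_lt_of_mem_limitPoints hlim
    exact ⟨hD.2.2 β hβ (limitPoints_mono inter_subset_left hlim), lt_trans hδ.2 hδβ⟩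

theorem IsStationaryIn.exists_gt {S D : Set Ordinal.{u}} {o γ : Ordinal.{u}}
    (hS : IsStationaryIn S o) (hD : IsClubIn D o) (hγ : γ < o) : ∃ β ∈ S, β ∈ D ∧ γ < β :=
  hS (hD.inter_Ioi hγ)

section Regular

variable {lam : Cardinal.{u}}

theorem exists_isPrincipal_gt (hreg : lam.IsRegular) (hunc : ℵ₀ < lam)
    {f : Ordinal.{u} → Ordinal.{u} → Ordinal.{u}} (hf : IsPrincipal f lam.ord)
    {γ : Ordinal.{u}} (hγ : γ < lam.ord) : ∃ β < lam.ord, γ < β ∧ IsPrincipal f β := by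
  let g : Ordinal.{u} → Ordinal.{u} := fun s => max s (sSup ((· + 1) '' image2 f (Iio s) (Iio s)))
  have hg : ∀ s < lam.ord, g s < lam.ord := fun s hs => by
    refine max_lt hs (sSup_add_one_lt_of_lt_cof (mk_image2_le.trans_lt ?_) ?_)
    · rw [Cardinal.mk_Iio_ordinal, ← lift_cof, hreg.cof_ord, ← Cardinal.lift_mul,
        Cardinal.lift_lt]
      exact Cardinal.mul_lt_of_lt hreg.aleph0_le (lt_ord.1 hs) (lt_ord.1 hs)
    · rintro _ ⟨τ, hτ, ξ, hξ, rfl⟩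
      exact hf (hτ.trans hs) (hξ.trans hs)
  have hlt : ∀ s, ∀ τ < s, ∀ ξ < s, f τ ξ < g s := fun s τ hτ ξ hξ => by
    have hmem : f τ ξ + 1 ∈ (· + 1) '' image2 f (Iio s) (Iio s) :=
      mem_image_of_mem (· + 1) (mem_image2_of_mem (mem_Iio.2 hτ) (mem_Iio.2 hξ))
    exact (lt_add_one _).trans_le
      ((le_csSup Ordinal.bddAbove_of_small hmem).trans (le_max_right _ _))
  have hmono : Monotone fun n : ℕ => g^[n] (succ γ) := monotone_nat_of_le_succ fun n => by
    rw [Function.iterate_succ_apply']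
    exact le_max_left _ _
  refine ⟨nfp g (succ γ), nfp_lt_ord (hreg.cof_ord.symm ▸ hunc) hg
    ((isSuccLimit_ord hreg.aleph0_le).succ_lt hγ), (lt_succ γ).trans_le (le_nfp g _),
    fun τ ξ hτ hξ => ?_⟩
  obtain ⟨m, hm⟩ := lt_nfp_iff.1 hτ
  obtain ⟨n, hn⟩ := lt_nfp_iff.1 hξ
  refine lt_nfp_iff.2 ⟨max m n + 1, ?_⟩
  rw [Function.iterate_succ_apply']
  exact hlt _ τ (hm.trans_le (hmono (le_max_left m n))) ξ (hn.trans_le (hmono (le_max_right m n)))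

theorem isClubIn_diagonal_inter (hreg : lam.IsRegular) (hunc : ℵ₀ < lam)
    {D : Ordinal.{u} → Set Ordinal.{u}} (hD : ∀ τ < lam.ord, IsClubIn (D τ) lam.ord) :
    IsClubIn {β | β < lam.ord ∧ ∀ τ < β, β ∈ D τ} lam.ord := by
  have hnext : ∀ τ ξ, ∃ δ, τ < lam.ord → ξ < lam.ord → δ ∈ D τ ∧ ξ < δ := fun τ ξ => by
    by_cases h : τ < lam.ord ∧ ξ < lam.ord
    · obtain ⟨δ, hδ, hlt⟩ := (hD τ h.1).2.1 ξ h.2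
      exact ⟨δ, fun _ _ => ⟨hδ, hlt⟩⟩
    · exact ⟨0, fun hτ hξ => absurd ⟨hτ, hξ⟩ h⟩
  choose next hnext using hnext
  refine ⟨fun β hβ => hβ.1, fun γ hγ => ?_, fun β hβ hlim => ⟨hβ, fun τ hτ => ?_⟩⟩
  · obtain ⟨β, hβ, hγβ, hprin⟩ := exists_isPrincipal_gt hreg hunc
      (fun τ ξ hτ hξ => (hD τ hτ).1 (hnext τ ξ hτ hξ).1) hγ
    refine ⟨β, ⟨hβ, fun τ hτ => (hD τ (hτ.trans hβ)).2.2 β hβ ⟨(pos_of_gt hτ).ne', fun ξ hξ =>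
      ⟨next τ ξ, ?_, ?_, hprin hτ hξ⟩⟩⟩, hγβ⟩
    exacts [(hnext τ ξ (hτ.trans hβ) (hξ.trans hβ)).1, (hnext τ ξ (hτ.trans hβ) (hξ.trans hβ)).2]
  · refine (hD τ (hτ.trans hβ)).2.2 β hβ ⟨hlim.1, fun ξ hξ => ?_⟩
    obtain ⟨δ, hδ, hlt, hδβ⟩ := hlim.2 _ (max_lt hτ hξ)
    exact ⟨δ, hδ.2 τ ((le_max_left _ _).trans_lt hlt), (le_max_right _ _).trans_lt hlt, hδβ⟩

theorem isClubIn_limitPoints (hreg : lam.IsRegular) (hunc : ℵ₀ < lam) {A : Set Ordinal.{u}}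
    (hAlam : A ⊆ Iio lam.ord) (hA : ∀ γ < lam.ord, ∃ δ ∈ A, γ < δ) :
    IsClubIn (limitPoints A ∩ Iio lam.ord) lam.ord := by
  choose! next hnext using hA
  refine ⟨inter_subset_right, fun γ hγ => ?_, fun β hβ hlim => ⟨⟨hlim.1, fun γ hγ => ?_⟩, hβ⟩⟩
  · obtain ⟨β, hβ, hγβ, hprin⟩ := exists_isPrincipal_gt hreg hunc (f := fun _ => next)
      (fun _ ξ _ hξ => hAlam (hnext ξ hξ).1) hγ
    exact ⟨β, ⟨⟨(pos_of_gt hγβ).ne', fun ξ hξ => ⟨next ξ, (hnext ξ (hξ.trans hβ)).1,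
      (hnext ξ (hξ.trans hβ)).2, hprin hξ hξ⟩⟩, hβ⟩, hγβ⟩
  · obtain ⟨μ, hμ, hγμ, hμβ⟩ := hlim.2 γ hγ
    obtain ⟨δ, hδ, hγδ, hδμ⟩ := hμ.1.2 γ hγμ
    exact ⟨δ, hδ, hγδ, hδμ.trans hμβ⟩

end Regular

/-! ### Coherent `C`-sequences -/

/-- `C` is a coherent `C`-sequence of length `o`. Unlike in `SquarePrinciple`, successor ordinals
are not exempt: there `C` picks out a cofinal set, that is, one containing the predecessor. -/
structure IsCoherentCSeq (C : Ordinal.{u} → Set Ordinal.{u}) (o : Ordinal.{u}) : Prop where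
  subset : ∀ γ < o, C γ ⊆ Iio γ
  exists_ge : ∀ γ < o, ∀ α < γ, ∃ η ∈ C γ, α ≤ η
  closed : ∀ γ < o, ∀ μ < γ, μ ∈ limitPoints (C γ) → μ ∈ C γ
  coherent : ∀ γ < o, ∀ μ < γ, μ ∈ limitPoints (C γ) → C μ = C γ ∩ Iio μ

/-- `D` is a thread through the `C`-sequence `C` of length `o`. -/
def IsThread (C : Ordinal.{u} → Set Ordinal.{u}) (D : Set Ordinal.{u}) (o : Ordinal.{u}) : Prop :=
  IsClubIn D o ∧ ∀ α < o, α ∈ limitPoints D → C α = D ∩ Iio α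

theorem not_mem_limitPoints_setOf_succ_eq {μ γ : Ordinal.{u}} :
    μ ∉ limitPoints {ξ | succ ξ = γ} := by
  intro hμ
  obtain ⟨δ, hδ, hδμ⟩ := exists_mem_lt_of_mem_limitPoints hμ
  obtain ⟨δ', hδ', hlt, -⟩ := hμ.2 δ hδμ
  exact hlt.ne (succ_injective (hδ.trans hδ'.symm))

theorem SquarePrinciple.exists_isCoherentCSeq {lam : Cardinal.{u}} (hsq : SquarePrinciple lam) :
    ∃ C, IsCoherentCSeq C lam.ord ∧ ∀ D, ¬ IsThread C D lam.ord := by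
  classical
  obtain ⟨C, hclub, hcoh, hthread⟩ := hsq
  let E : Ordinal.{u} → Set Ordinal.{u} := fun γ =>
    if IsSuccLimit γ then C γ else {ξ | succ ξ = γ}
  have hElim : ∀ {γ}, IsSuccLimit γ → E γ = C γ := fun h => if_pos h
  have hEsucc : ∀ {γ}, ¬ IsSuccLimit γ → E γ = {ξ | succ ξ = γ} := fun h => if_neg h
  have hlim : ∀ {γ μ}, μ ∈ limitPoints (E γ) → IsSuccLimit γ := fun {γ μ} hμ => by
    by_contra hγ
    exact not_mem_limitPoints_setOf_succ_eq (hEsucc hγ ▸ hμ)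
  refine ⟨E, ⟨fun γ hγ => ?_, fun γ hγ α hα => ?_, fun γ hγ μ hμγ hμ => ?_,
    fun γ hγ μ hμγ hμ => ?_⟩, fun D hD => hthread ⟨D, hD.1, fun α hα hαD => ?_⟩⟩
  · by_cases h : IsSuccLimit γ
    · exact hElim h ▸ (hclub γ hγ h).1
    · rw [hEsucc h]
      rintro ξ rfl
      exact lt_succ ξ
  · by_cases h : IsSuccLimit γ
    · obtain ⟨η, hη, hlt⟩ := (hclub γ hγ h).2.1 α hα
      exact ⟨η, hElim h ▸ hη, hlt.le⟩
    · rcases zero_or_succ_or_isSuccLimit γ with rfl | ⟨ξ, rfl⟩ | hγlim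
      · exact absurd hα not_lt_zero
      · exact ⟨ξ, by rw [hEsucc h]; rfl, lt_succ_iff.1 hα⟩
      · exact absurd hγlim h
  · have h := hlim hμ
    rw [hElim h] at hμ ⊢
    exact (hclub γ hγ h).2.2 μ hμγ hμ
  · rw [hElim (isSuccLimit_of_mem_limitPoints hμ), hElim (hlim hμ)]
    exact hcoh γ hγ (hlim hμ) μ hμγ (hElim (hlim hμ) ▸ hμ)
  · exact hElim (isSuccLimit_of_mem_limitPoints hαD) ▸ hD.2 α hα hαD

/-- The `C`-sequence `C` with the parts below `ζ` cut off its members of index above `ζ`. -/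
def cutBelow (C : Ordinal.{u} → Set Ordinal.{u}) (ζ γ : Ordinal.{u}) : Set Ordinal.{u} :=
  {ξ ∈ C γ | ζ < γ → ζ ≤ ξ}

theorem cutBelow_subset {C : Ordinal.{u} → Set Ordinal.{u}} {ζ γ : Ordinal.{u}} :
    cutBelow C ζ γ ⊆ C γ :=
  fun _ h => h.1

theorem lt_of_mem_limitPoints_cutBelow {C : Ordinal.{u} → Set Ordinal.{u}} {ζ γ μ : Ordinal.{u}}
    (hμ : μ ∈ limitPoints (cutBelow C ζ γ)) (hζ : ζ < γ) : ζ < μ :=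
  let ⟨_, hδ, hδμ⟩ := exists_mem_lt_of_mem_limitPoints hμ
  (hδ.2 hζ).trans_lt hδμ

namespace IsCoherentCSeq

variable {C : Ordinal.{u} → Set Ordinal.{u}} {o : Ordinal.{u}}

theorem exists_isLeast (hC : IsCoherentCSeq C o) {α γ : Ordinal.{u}} (hγ : γ < o) (hα : α < γ) :
    ∃ η, IsLeast (C γ ∩ Ici α) η :=
  ⟨_, csInf_mem (hC.exists_ge γ hγ α hα), fun _ hξ => csInf_le' hξ⟩

theorem exists_isGreatest_limitPoints (hC : IsCoherentCSeq C o) {β γ : Ordinal.{u}} (hγ : γ < o)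
    (hβ : β < γ) (hne : (limitPoints (C γ) ∩ Iic β).Nonempty) :
    ∃ ν ∈ C γ, IsGreatest (limitPoints (C γ) ∩ Iic β) ν := by
  have hbdd : BddAbove (limitPoints (C γ) ∩ Iic β) := ⟨β, fun _ h => h.2⟩
  have hmem := sSup_mem_limitPoints inter_subset_left hne hbdd
  have hle : sSup (limitPoints (C γ) ∩ Iic β) ≤ β := csSup_le hne fun _ h => h.2
  exact ⟨_, hC.closed γ hγ _ (hle.trans_lt hβ) hmem, ⟨hmem, hle⟩, fun ξ hξ => le_csSup hbdd hξ⟩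

theorem isThread_of_frequently_eq (hC : IsCoherentCSeq C o) {D : Set Ordinal.{u}}
    (hD : D ⊆ Iio o) (hfreq : ∀ γ < o, ∃ β < o, γ < β ∧ C β = D ∩ Iio β) : IsThread C D o := by
  refine ⟨⟨hD, fun γ hγ => ?_, fun α hα hαD => ?_⟩, fun α hα hαD => ?_⟩
  · obtain ⟨β, hβ, hγβ, -⟩ := hfreq γ hγ
    obtain ⟨β', hβ', hββ', hCβ'⟩ := hfreq β hβ
    obtain ⟨δ, hδ, hβδ⟩ := hC.exists_ge β' hβ' β hββ'
    exact ⟨δ, (hCβ' ▸ hδ).1, hγβ.trans_le hβδ⟩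
  all_goals
    obtain ⟨β, hβ, hαβ, hCβ⟩ := hfreq α hα
    have hαlim : α ∈ limitPoints (C β) := by rwa [hCβ, mem_limitPoints_inter_Iio hαβ.le]
  · exact (hCβ ▸ hC.closed β hβ α hαβ hαlim).1
  · rw [hC.coherent β hβ α hαβ hαlim, hCβ, inter_assoc, Iio_inter_Iio, inf_eq_right.2 hαβ.le]

protected theorem cutBelow (hC : IsCoherentCSeq C o) (ζ : Ordinal.{u}) :
    IsCoherentCSeq (cutBelow C ζ) o where
  subset γ hγ := cutBelow_subset.trans (hC.subset γ hγ)
  exists_ge γ hγ α hα := by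
    by_cases hζ : ζ < γ
    · obtain ⟨η, hη, hle⟩ := hC.exists_ge γ hγ _ (max_lt hα hζ)
      exact ⟨η, ⟨hη, fun _ => (le_max_right _ _).trans hle⟩, (le_max_left _ _).trans hle⟩
    · obtain ⟨η, hη, hle⟩ := hC.exists_ge γ hγ α hα
      exact ⟨η, ⟨hη, fun h => absurd h hζ⟩, hle⟩
  closed γ hγ μ hμγ hμ := ⟨hC.closed γ hγ μ hμγ (limitPoints_mono cutBelow_subset hμ),
    fun hζ => (lt_of_mem_limitPoints_cutBelow hμ hζ).le⟩
  coherent γ hγ μ hμγ hμ := by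
    have hiff : ζ < μ ↔ ζ < γ := ⟨fun h => h.trans hμγ, lt_of_mem_limitPoints_cutBelow hμ⟩
    ext ξ
    simp only [cutBelow, hC.coherent γ hγ μ hμγ (limitPoints_mono cutBelow_subset hμ), hiff,
      mem_inter_iff, mem_ofPred_eq, and_right_comm]

end IsCoherentCSeq

/-- The weights `h` are constant along the limit points of each member of the `C`-sequence `C`. -/
def IsCoherentWeight (C : Ordinal.{u} → Set Ordinal.{u}) (h : Ordinal.{u} → ℕ)
    (o : Ordinal.{u}) : Prop :=
  ∀ γ < o, ∀ μ < γ, μ ∈ limitPoints (C γ) → h μ = h γ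

section Unthreaded

variable {lam : Cardinal.{u}} {C : Ordinal.{u} → Set Ordinal.{u}}

theorem exists_isStationaryIn_mem_and_notMem (hreg : lam.IsRegular) (hunc : ℵ₀ < lam)
    (hC : IsCoherentCSeq C lam.ord) (hthread : ∀ D, ¬ IsThread C D lam.ord)
    {S : Set Ordinal.{u}} (hS : IsStationaryIn S lam.ord) :
    ∃ ζ < lam.ord, IsStationaryIn {β ∈ S | ζ ∈ C β} lam.ord ∧
      IsStationaryIn {β ∈ S | ζ ∉ C β} lam.ord := by
  by_contra! hsplit
  let D : Set Ordinal.{u} := {ζ | ζ < lam.ord ∧ IsStationaryIn {β ∈ S | ζ ∈ C β} lam.ord}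
  have hdecided : ∀ ζ < lam.ord, ∃ E, IsClubIn E lam.ord ∧ ∀ β ∈ S, β ∈ E → (ζ ∈ C β ↔ ζ ∈ D) := by
    intro ζ hζ
    by_cases hst : IsStationaryIn {β ∈ S | ζ ∈ C β} lam.ord
    · have hnst := hsplit ζ hζ hst
      simp only [IsStationaryIn, not_forall, not_nonempty_iff_eq_empty] at hnst
      obtain ⟨E, hE, hempty⟩ := hnst
      exact ⟨E, hE, fun β hβS hβE => iff_of_true
        (not_not.1 fun hn => hempty.le ⟨⟨hβS, hn⟩, hβE⟩) ⟨hζ, hst⟩⟩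
    · have hnst := hst
      simp only [IsStationaryIn, not_forall, not_nonempty_iff_eq_empty] at hnst
      obtain ⟨E, hE, hempty⟩ := hnst
      exact ⟨E, hE, fun β hβS hβE => iff_of_false
        (fun hmem => hempty.le ⟨⟨hβS, hmem⟩, hβE⟩) fun h => hst h.2⟩
  choose! E hE hED using hdecided
  refine hthread D (hC.isThread_of_frequently_eq (fun _ h => h.1) fun γ hγ => ?_)
  obtain ⟨β, hβS, ⟨hβ, hβE⟩, hγβ⟩ := hS.exists_gt (isClubIn_diagonal_inter hreg hunc hE) hγ
  have hiff : ∀ ζ < β, (ζ ∈ C β ↔ ζ ∈ D) := fun ζ hζ =>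
    hED ζ (hζ.trans hβ) β hβS (hβE ζ hζ)
  refine ⟨β, hβ, hγβ, Set.ext fun ζ => ⟨fun h => ?_, fun h => (hiff ζ h.2).2 h.1⟩⟩
  have hζβ := hC.subset β hβ h
  exact ⟨(hiff ζ hζβ).1 h, hζβ⟩

theorem exists_seq_isStationaryIn (hreg : lam.IsRegular) (hunc : ℵ₀ < lam)
    (hC : IsCoherentCSeq C lam.ord) (hthread : ∀ D, ¬ IsThread C D lam.ord) :
    ∃ ζ : ℕ → Ordinal.{u}, (∀ n, ζ n < lam.ord) ∧
      ∀ n, IsStationaryIn {β | (∀ k < n, ζ k ∈ C β) ∧ ζ n ∉ C β} lam.ord := by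
  have hsplit := fun S => exists_isStationaryIn_mem_and_notMem hreg hunc hC hthread (S := S)
  choose! z hz using hsplit
  let S : ℕ → Set Ordinal.{u} := fun n => (fun T => {β ∈ T | z T ∈ C β})^[n] Set.univ
  have hSsucc : ∀ n, S (n + 1) = {β ∈ S n | z (S n) ∈ C β} := fun n =>
    Function.iterate_succ_apply' _ n Set.univ
  have hSst : ∀ n, IsStationaryIn (S n) lam.ord := fun n => by
    induction n with
    | zero =>
      intro D hD
      obtain ⟨δ, hδ, -⟩ := hD.2.1 0 hreg.ord_pos
      exact ⟨δ, mem_univ δ, hδ⟩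
    | succ n ih => exact hSsucc n ▸ (hz _ ih).2.1
  have hSeq : ∀ n, S n = {β | ∀ k < n, z (S k) ∈ C β} := fun n => by
    induction n with
    | zero => simp [S]
    | succ n ih =>
      rw [hSsucc]
      ext β
      conv_lhs => rw [ih]
      simp only [mem_ofPred_eq, Nat.forall_lt_succ_right, ih]
  refine ⟨fun n => z (S n), fun n => (hz _ (hSst n)).1, fun n => ?_⟩
  convert (hz _ (hSst n)).2.2 using 1
  ext β
  simp only [mem_ofPred_eq]
  nth_rw 2 [hSeq n]
  rfl

theorem SquarePrinciple.exists_isCoherentWeight (hreg : lam.IsRegular) (hunc : ℵ₀ < lam)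
    (hsq : SquarePrinciple lam) :
    ∃ C h, IsCoherentCSeq C lam.ord ∧ IsCoherentWeight C h lam.ord ∧
      ∀ n, IsStationaryIn {β | h β = n} lam.ord := by
  classical
  obtain ⟨C, hC, hthread⟩ := hsq.exists_isCoherentCSeq
  obtain ⟨z, hz, hst⟩ := exists_seq_isStationaryIn hreg hunc hC hthread
  have hζ : ⨆ n, z n < lam.ord := lift_iSup_lt_of_lt_cof (by simpa [hreg.cof_ord] using hunc) hz
  set ζ := ⨆ n, z n
  refine ⟨cutBelow C ζ, fun γ => if ζ < γ then sInf {n | z n ∉ C γ} else 0,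
    hC.cutBelow ζ, fun γ hγ μ hμγ hμ => ?_, fun n D hD => ?_⟩
  · by_cases hζγ : ζ < γ
    · have hζμ := lt_of_mem_limitPoints_cutBelow hμ hζγ
      have hCμ := hC.coherent γ hγ μ hμγ (limitPoints_mono cutBelow_subset hμ)
      have hzμ : ∀ n, z n < μ := fun n => (Ordinal.le_iSup z n).trans_lt hζμ
      simp only [if_pos hζγ, if_pos hζμ, hCμ, mem_inter_iff, mem_Iio, hzμ, and_true]
    · simp only [if_neg hζγ, if_neg fun h : ζ < μ => hζγ (h.trans hμγ)]
  · obtain ⟨β, ⟨hmem, hnotMem⟩, hβD, hζβ⟩ := (hst n).exists_gt hD hζ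
    have hleast : IsLeast {n | z n ∉ C β} n :=
      ⟨hnotMem, fun k hk => not_lt.1 fun hkn => hk (hmem k hkn)⟩
    exact ⟨β, (if_pos hζβ).trans hleast.csInf_eq, hβD⟩

end Unthreaded

/-! ### Walks along a coherent `C`-sequence -/

/-- The elements of `A` below `α` that are not below any limit point of `A` up to `α`. -/
def tailPoints (A : Set Ordinal.{u}) (α : Ordinal.{u}) : Set Ordinal.{u} :=
  {ξ ∈ A | ξ < α ∧ ∀ μ ∈ limitPoints A, μ ≤ α → μ ≤ ξ}

theorem finite_tailPoints (A : Set Ordinal.{u}) (α : Ordinal.{u}) : (tailPoints A α).Finite := by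
  by_contra hinf
  obtain ⟨μ, hμ, hμα⟩ := exists_mem_limitPoints_of_infinite hinf fun ξ hξ => hξ.2.1
  obtain ⟨ξ, hξ, hξμ⟩ := exists_mem_lt_of_mem_limitPoints hμ
  exact hξμ.not_ge (hξ.2.2 μ (limitPoints_mono (fun _ h => h.1) hμ) hμα)

/-- `ρ(α, γ) ≤ n`, where Todorčević's function `ρ` is defined by recursion along the walks through
`C`: it vanishes on the diagonal, and `ρ(α, γ)` is the maximum of the weight `h γ`, of
`ρ(α, min (C γ \ α))`, and of the finitely many `ρ(ξ, α)` for `ξ ∈ tailPoints (C γ) α`. -/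
inductive WalkBound (C : Ordinal.{u} → Set Ordinal.{u}) (h : Ordinal.{u} → ℕ) (n : ℕ) :
    Ordinal.{u} → Ordinal.{u} → Prop
  | refl (α : Ordinal.{u}) : WalkBound C h n α α
  | step {α γ η : Ordinal.{u}} (hlt : α < γ) (hn : h γ ≤ n) (hη : IsLeast (C γ ∩ Ici α) η)
      (hw : WalkBound C h n α η) (ht : ∀ ξ ∈ tailPoints (C γ) α, WalkBound C h n ξ α) :
      WalkBound C h n α γ

namespace WalkBound

variable {C : Ordinal.{u} → Set Ordinal.{u}} {h : Ordinal.{u} → ℕ} {m n : ℕ} {α γ : Ordinal.{u}}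

theorem inv (hw : WalkBound C h n α γ) (hlt : α < γ) :
    h γ ≤ n ∧ (∃ η, IsLeast (C γ ∩ Ici α) η ∧ WalkBound C h n α η) ∧
      ∀ ξ ∈ tailPoints (C γ) α, WalkBound C h n ξ α := by
  cases hw with
  | refl => exact absurd hlt (lt_irrefl _)
  | step _ hn hη hw ht => exact ⟨hn, ⟨_, hη, hw⟩, ht⟩

theorem mono (hmn : m ≤ n) (hw : WalkBound C h m α γ) : WalkBound C h n α γ := by
  induction hw with
  | refl => exact .refl _
  | step hlt hn hη _ _ ih ih' => exact .step hlt (hn.trans hmn) hη ih ih'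

end WalkBound

namespace IsCoherentCSeq

variable {C : Ordinal.{u} → Set Ordinal.{u}} {h : Ordinal.{u} → ℕ} {o α β γ : Ordinal.{u}} {n : ℕ}

theorem walkBound_iff_of_mem_limitPoints (hC : IsCoherentCSeq C o) (hh : IsCoherentWeight C h o)
    {μ : Ordinal.{u}} (hγ : γ < o) (hμγ : μ < γ) (hμ : μ ∈ limitPoints (C γ)) (hα : α < μ) :
    WalkBound C h n α γ ↔ WalkBound C h n α μ := by
  have hcoh := hC.coherent γ hγ μ hμγ hμ
  have hweight := hh γ hγ μ hμγ hμ
  have htail : tailPoints (C μ) α = tailPoints (C γ) α := by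
    have hlim : ∀ ν ≤ α, ν ∈ limitPoints (C μ) ↔ ν ∈ limitPoints (C γ) := fun ν hν => by
      rw [hcoh, mem_limitPoints_inter_Iio (hν.trans hα.le)]
    ext ξ
    refine ⟨fun hξ => ⟨?_, hξ.2.1, fun ν hν hνα => hξ.2.2 ν ((hlim ν hνα).2 hν) hνα⟩,
      fun hξ => ⟨?_, hξ.2.1, fun ν hν hνα => hξ.2.2 ν ((hlim ν hνα).1 hν) hνα⟩⟩
    · exact inter_subset_left (hcoh ▸ hξ.1)
    · exact hcoh ▸ ⟨hξ.1, hξ.2.1.trans hα⟩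
  have hleast : ∀ η, IsLeast (C μ ∩ Ici α) η ↔ IsLeast (C γ ∩ Ici α) η := fun η => by
    rw [hcoh, inter_right_comm]
    obtain ⟨δ, hδ, hαδ, hδμ⟩ := hμ.2 α hα
    refine ⟨fun hη => ⟨hη.1.1, fun ξ hξ => ?_⟩, fun hη => ⟨⟨hη.1, ?_⟩, fun ξ hξ => hη.2 hξ.1⟩⟩
    · exact (lt_or_ge ξ μ).elim (fun hξμ => hη.2 ⟨hξ, hξμ⟩) hη.1.2.le.trans
    · exact (hη.2 ⟨hδ, hαδ.le⟩).trans_lt hδμ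
  constructor
  · intro hw
    obtain ⟨hn, ⟨η, hη, hηw⟩, ht⟩ := hw.inv (hα.trans hμγ)
    exact .step hα (hweight ▸ hn) ((hleast η).2 hη) hηw (htail ▸ ht)
  · intro hw
    obtain ⟨hn, ⟨η, hη, hηw⟩, ht⟩ := hw.inv hα
    exact .step (hα.trans hμγ) (hweight ▸ hn) ((hleast η).1 hη) hηw (htail ▸ ht)

theorem walkBound_iff (hC : IsCoherentCSeq C o) (hh : IsCoherentWeight C h o) (hγ : γ < o)
    (hαβ : α ≤ β) (hβγ : β ≤ γ) (hw : WalkBound C h n β γ) :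
    WalkBound C h n α γ ↔ WalkBound C h n α β := by
  induction γ using WellFoundedLT.induction generalizing α β with
  | _ γ ih =>
  rcases hαβ.eq_or_lt with rfl | hαβ
  · exact iff_of_true hw (.refl _)
  rcases hβγ.eq_or_lt with rfl | hβγ
  · rfl
  have ihβ := fun {α ξ} => ih β hβγ (hβγ.trans hγ) (α := α) (β := ξ)
  obtain ⟨hn, ⟨θ, hθ, hθw⟩, htail⟩ := hw.inv hβγ
  by_cases hlim : ∃ μ ∈ limitPoints (C γ), α < μ ∧ μ ≤ β
  · obtain ⟨μ, hμ, hαμ, hμβ⟩ := hlim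
    obtain ⟨ν, hνC, ⟨hν, hνβ⟩, hmax⟩ := hC.exists_isGreatest_limitPoints hγ hβγ ⟨μ, hμ, hμβ⟩
    have hαν : α < ν := hαμ.trans_le (hmax ⟨hμ, hμβ⟩)
    have hνw : WalkBound C h n ν β := by
      rcases eq_or_lt_of_le (mem_Iic.1 hνβ) with rfl | hνβ
      · exact .refl _
      · exact htail ν ⟨hνC, hνβ, fun ξ hξ hξβ => hmax ⟨hξ, hξβ⟩⟩
    exact (hC.walkBound_iff_of_mem_limitPoints hh hγ (hνβ.trans_lt hβγ) hν hαν).trans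
      (ihβ hαν.le hνβ hνw).symm
  · have hle : ∀ μ ∈ limitPoints (C γ), μ ≤ β → μ ≤ α := fun μ hμ hμβ =>
      not_lt.1 fun hαμ => hlim ⟨μ, hμ, hαμ, hμβ⟩
    obtain ⟨η, hη⟩ := hC.exists_isLeast hγ (hαβ.trans hβγ)
    have hηiff : WalkBound C h n α η ↔ WalkBound C h n α β := by
      rcases lt_or_ge η β with hηβ | hβη
      · exact (ihβ hη.1.2 hηβ.le (htail η ⟨hη.1.1, hηβ, fun μ hμ hμβ =>
          (hle μ hμ hμβ).trans hη.1.2⟩)).symm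
      · obtain rfl : η = θ := le_antisymm (hη.2 ⟨hθ.1.1, hαβ.le.trans hθ.1.2⟩)
          (hθ.2 ⟨hη.1.1, hβη⟩)
        have hηγ := hC.subset γ hγ hη.1.1
        exact ih η hηγ (hηγ.trans hγ) hαβ.le hβη hθw
    refine ⟨fun hαγ => ?_, fun hαw => ?_⟩
    · obtain ⟨-, ⟨η', hη', hη'w⟩, -⟩ := hαγ.inv (hαβ.trans hβγ)
      exact hηiff.1 (hη.unique hη' ▸ hη'w)
    · refine .step (hαβ.trans hβγ) hn hη (hηiff.2 hαw) fun ξ hξ => ?_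
      exact (ihβ hξ.2.1.le hαβ.le hαw).1 (htail ξ ⟨hξ.1, hξ.2.1.trans hαβ, fun μ hμ hμβ =>
        hξ.2.2 μ hμ (hle μ hμ hμβ)⟩)

theorem exists_walkBound (hC : IsCoherentCSeq C o) (hγ : γ < o) (hα : α ≤ γ) :
    ∃ n, WalkBound C h n α γ := by
  induction γ using WellFoundedLT.induction generalizing α with
  | _ γ ih =>
  rcases hα.eq_or_lt with rfl | hα
  · exact ⟨0, .refl _⟩
  obtain ⟨η, hη⟩ := hC.exists_isLeast hγ hα
  have hηγ := hC.subset γ hγ hη.1.1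
  obtain ⟨n, hn⟩ := ih η hηγ (hηγ.trans hγ) hη.1.2
  have htail : ∀ ξ ∈ tailPoints (C γ) α, ∃ k, WalkBound C h k ξ α := fun ξ hξ =>
    ih α hα (hα.trans hγ) hξ.2.1.le
  choose! f hf using htail
  obtain ⟨m, hm⟩ := ((finite_tailPoints (C γ) α).image f).bddAbove
  exact ⟨max (h γ) (max n m), .step hα (le_max_left _ _) hη
    (hn.mono ((le_max_left _ _).trans (le_max_right _ _))) fun ξ hξ => (hf ξ hξ).mono
      ((hm ⟨ξ, hξ, rfl⟩).trans ((le_max_right _ _).trans (le_max_right _ _)))⟩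

theorem weight_le_of_walkBound (hC : IsCoherentCSeq C o) (hh : IsCoherentWeight C h o)
    {A : Set Ordinal.{u}} (hβ : β ∈ limitPoints A) (hγ : γ < o) (hβγ : β ≤ γ) {ζ : Ordinal.{u}}
    (hζ : ζ < β) (hw : ∀ α ∈ A, ζ < α → α < β → WalkBound C h n α γ) : h β ≤ n := by
  induction γ using WellFoundedLT.induction generalizing ζ with
  | _ γ ih =>
  obtain ⟨α, hα, hζα, hαβ⟩ := hβ.2 ζ hζ
  have hγn : h γ ≤ n := ((hw α hα hζα hαβ).inv (hαβ.trans_le hβγ)).1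
  rcases hβγ.eq_or_lt with rfl | hβγ
  · exact hγn
  by_cases hlim : β ∈ limitPoints (C γ)
  · exact (hh γ hγ β hβγ hlim).trans_le hγn
  obtain ⟨ξ, hξ, hgap⟩ : ∃ ξ < β, ∀ δ ∈ C γ, ξ < δ → β ≤ δ := by
    by_contra! hcon
    exact hlim ⟨hβ.1, hcon⟩
  obtain ⟨η, hη⟩ := hC.exists_isLeast hγ hβγ
  have hηγ := hC.subset γ hγ hη.1.1
  refine ih η hηγ (hηγ.trans hγ) hη.1.2 (max_lt hζ hξ) fun α hα hlt hαβ => ?_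
  obtain ⟨hζα, hξα⟩ := max_lt_iff.1 hlt
  obtain ⟨-, ⟨θ, hθ, hθw⟩, -⟩ := (hw α hα hζα hαβ).inv (hαβ.trans hβγ)
  have hηα : IsLeast (C γ ∩ Ici α) η := ⟨⟨hη.1.1, hαβ.le.trans hη.1.2⟩, fun δ hδ =>
    hη.2 ⟨hδ.1, hgap δ hδ.1 (hξα.trans_le hδ.2)⟩⟩
  exact hηα.unique hθ ▸ hθw

theorem exists_not_walkBound {lam : Cardinal.{u}} (hreg : lam.IsRegular) (hunc : ℵ₀ < lam)
    (hC : IsCoherentCSeq C lam.ord) (hh : IsCoherentWeight C h lam.ord)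
    (hst : ∀ n, IsStationaryIn {β | h β = n} lam.ord) {A : Set Ordinal.{u}}
    (hAlam : A ⊆ Iio lam.ord) (hA : ∀ γ < lam.ord, ∃ δ ∈ A, γ < δ) (n : ℕ) :
    ∃ α ∈ A, ∃ β ∈ A, α < β ∧ ¬ WalkBound C h n α β := by
  by_contra! hcon
  obtain ⟨β, hβn, hβA, hβ⟩ := hst (n + 1) (isClubIn_limitPoints hreg hunc hAlam hA)
  obtain ⟨γ, hγA, hβγ⟩ := hA β hβ
  have hle : h β ≤ n := hC.weight_le_of_walkBound hh hβA (hAlam hγA) hβγ.le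
    (pos_iff_ne_zero.2 hβA.1) fun α hα _ hαβ => hcon α hα γ hγA (hαβ.trans hβγ)
  exact absurd (hβn.symm.trans_le hle) (Nat.not_succ_le_self n)

end IsCoherentCSeq

/-- Todorčević's function `ρ`: the least `n` with `WalkBound C h n α γ`. -/
noncomputable def walkWeight (C : Ordinal.{u} → Set Ordinal.{u}) (h : Ordinal.{u} → ℕ)
    (α γ : Ordinal.{u}) : ℕ :=
  sInf {n | WalkBound C h n α γ}

theorem IsCoherentCSeq.walkWeight_le_iff {C : Ordinal.{u} → Set Ordinal.{u}}
    {h : Ordinal.{u} → ℕ} {o α γ : Ordinal.{u}} (hC : IsCoherentCSeq C o) (hγ : γ < o)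
    (hα : α ≤ γ) {n : ℕ} : walkWeight C h α γ ≤ n ↔ WalkBound C h n α γ :=
  ⟨fun hn => (Nat.sInf_mem (hC.exists_walkBound hγ hα)).mono hn, fun hw => Nat.sInf_le hw⟩

theorem SquarePrinciple.exists_isSubadditive_isStronglyUnbounded {lam : Cardinal.{u}}
    (hreg : lam.IsRegular) (hunc : ℵ₀ < lam) (hsq : SquarePrinciple lam) :
    ∃ c : OrdPairs lam.ord → Iio (ℵ₀ : Cardinal.{u}).ord,
      IsSubadditive c ∧ IsStronglyUnbounded c := by
  obtain ⟨C, h, hC, hh, hst⟩ := hsq.exists_isCoherentWeight hreg hunc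
  refine ⟨fun p => ⟨(walkWeight C h p.1.1 p.1.2 : Ordinal.{u}), by simp⟩,
    fun α β γ hαβ hβγ => ?_, fun A hA hbdd => ?_⟩
  · have hle : ∀ {α β : Iio lam.ord} {n}, α ≤ β →
        (walkWeight C h α β ≤ n ↔ WalkBound C h n α β) := fun {_ β _} hαβ =>
      hC.walkWeight_le_iff β.2 hαβ
    have hw : ∀ {n}, WalkBound C h n β γ → (WalkBound C h n α γ ↔ WalkBound C h n α β) :=
      hC.walkBound_iff hh γ.2 hαβ.le hβγ.le
    simp only [le_max_iff, Subtype.mk_le_mk, Nat.cast_le]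
    rw [← le_max_iff, ← le_max_iff, hle (hαβ.trans hβγ).le, hle hαβ.le]
    exact ⟨(hw ((hle hβγ.le).1 (le_max_right _ _))).2 ((hle hαβ.le).1 (le_max_left _ _)),
      (hw ((hle hβγ.le).1 (le_max_right _ _))).1 ((hle (hαβ.trans hβγ).le).1 (le_max_left _ _))⟩
  · obtain ⟨⟨b, hb⟩, hcb⟩ := hbdd
    obtain ⟨n, rfl⟩ := lt_omega0.1 (by simpa using hb : b < ω)
    have hAlam : ∀ γ < lam.ord, ∃ δ ∈ Subtype.val '' A, γ < δ := fun γ hγ => by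
      obtain ⟨δ, hδ, hlt⟩ := not_bddAbove_iff.1 hA ⟨γ, hγ⟩
      exact ⟨δ, mem_image_of_mem _ hδ, hlt⟩
    obtain ⟨_, ⟨α, hα, rfl⟩, _, ⟨β, hβ, rfl⟩, hαβ, hn⟩ :=
      hC.exists_not_walkBound hreg hunc hh hst (by simp) hAlam n
    refine hn ((hC.walkWeight_le_iff β.2 hαβ.le).1 ?_)
    exact Nat.cast_le.1 (Subtype.coe_le_coe.2 (hcb ⟨⟨(α, β), hαβ⟩, ⟨hα, hβ⟩, rfl⟩))

/-! ### Strong clubs in `𝒫_κ X` -/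

section StrongClub

variable {κ : Cardinal.{u}} {X C : Set ZFSet.{u}}

theorem card_iUnion_lt (hκ : κ.IsRegular) {ι : Type v} [Small.{u} ι]
    (hι : Cardinal.lift.{u} #ι < Cardinal.lift.{v} κ) {f : ι → ZFSet.{u}}
    (hf : ∀ i, (f i).card < κ) : (ZFSet.iUnion f).card < κ := by
  have hreindex : ZFSet.iUnion f = ZFSet.iUnion (f ∘ (equivShrink.{u} ι).symm) := by
    ext y
    simp only [ZFSet.mem_iUnion, Function.comp_apply, (equivShrink ι).symm.exists_congr_left,
      Equiv.symm_symm, Equiv.symm_apply_apply]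
  have hshrink : #(Shrink.{u} ι) < κ := by
    rw [← Cardinal.lift_lt.{u, v}]
    exact (Cardinal.lift_mk_eq'.2 ⟨(equivShrink ι).symm⟩).trans_lt hι
  have hsum := ZFSet.lift_card_iUnion_le_sum_card (f := f ∘ (equivShrink.{u} ι).symm)
  rw [Cardinal.lift_id] at hsum
  exact hreindex ▸ hsum.trans_lt (sum_lt_of_isRegular hκ hshrink fun i => hf _)

theorem card_union_lt (hκ : ℵ₀ ≤ κ) {x y : ZFSet.{u}} (hx : x.card < κ) (hy : y.card < κ) :
    (x ∪ y).card < κ :=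
  ZFSet.card_union_le.trans_lt (add_lt_of_lt hκ hx hy)

theorem card_insert_lt (hκ : ℵ₀ ≤ κ) {x y : ZFSet.{u}} (hy : y.card < κ) :
    (insert x y).card < κ :=
  ZFSet.card_insert_le.trans_lt (add_lt_of_lt hκ hy (one_lt_aleph0.trans_le hκ))

theorem iUnion_mem_smallSubsets (hκ : κ.IsRegular) {ι : Type v} [Small.{u} ι]
    (hι : Cardinal.lift.{u} #ι < Cardinal.lift.{v} κ) {f : ι → ZFSet.{u}}
    (hf : ∀ i, f i ∈ smallSubsets κ X) : ZFSet.iUnion f ∈ smallSubsets κ X := by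
  refine ⟨fun y hy => ?_, card_iUnion_lt hκ hι fun i => (hf i).2⟩
  obtain ⟨i, hi⟩ := ZFSet.mem_iUnion.1 hy
  exact (hf i).1 y hi

theorem sUnion_mem_smallSubsets (hκ : κ.IsRegular) {D : ZFSet.{u}} (hD : D.card < κ)
    (h : ∀ M ∈ D, M ∈ smallSubsets κ X) : ZFSet.sUnion D ∈ smallSubsets κ X := by
  have : ZFSet.sUnion D = ZFSet.iUnion fun M : D => M.1 := by
    ext y
    simp
  rw [this]
  refine iUnion_mem_smallSubsets hκ ?_ fun M => h _ M.2
  simpa [ZFSet.cardinalMk_coe_sort] using hD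

theorem union_mem_smallSubsets (hκ : ℵ₀ ≤ κ) {A B : ZFSet.{u}} (hA : A ∈ smallSubsets κ X)
    (hB : B ∈ smallSubsets κ X) : A ∪ B ∈ smallSubsets κ X :=
  ⟨fun y hy => (ZFSet.mem_union.1 hy).elim (hA.1 y) (hB.1 y), card_union_lt hκ hA.2 hB.2⟩

theorem IsStrongClub.iUnion_mem (hC : IsStrongClub κ X C) {ι : Type v} [Small.{u} ι] [Nonempty ι]
    (hι : Cardinal.lift.{u} #ι < Cardinal.lift.{v} κ) {f : ι → ZFSet.{u}} (hf : ∀ i, f i ∈ C) :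
    ZFSet.iUnion f ∈ C := by
  refine hC.2 (ZFSet.range f) ?_ ?_ ?_
  · exact ⟨f (Classical.arbitrary ι), ZFSet.mem_range_self _⟩
  · rintro _ hM
    obtain ⟨i, rfl⟩ := ZFSet.mem_range.1 hM
    exact hf i
  · exact Cardinal.lift_lt.1 (ZFSet.lift_card_range_le.trans_lt hι)

theorem isStrongClub_setOf_closed (hκ : κ.IsRegular) (hunc : ℵ₀ < κ) {G : ZFSet.{u} → ZFSet.{u}}
    (hG : ∀ a, (G a).card < κ) :
    IsStrongClub κ X {M | M ∈ smallSubsets κ X ∧ ∀ a ∈ M, ∀ y ∈ G a, y ∈ X → y ∈ M} := by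
  refine ⟨⟨fun M hM => hM.1, fun A hA => ?_⟩, fun D _ hD hcard => ⟨?_, fun a ha y hy hyX => ?_⟩⟩
  · let step (B : ZFSet.{u}) : ZFSet.{u} :=
      B ∪ ZFSet.iUnion fun a : B => (G a.1).sep (· ∈ X)
    let stage (n : ℕ) : ZFSet.{u} := step^[n] A
    have hstage : ∀ n, stage n ∈ smallSubsets κ X := fun n => by
      refine Function.Iterate.rec (· ∈ smallSubsets κ X) hA (fun B hB => ?_) n
      refine union_mem_smallSubsets hκ.aleph0_le hB (iUnion_mem_smallSubsets hκ ?_ fun a => ?_)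
      · simpa [ZFSet.cardinalMk_coe_sort] using hB.2
      · exact ⟨fun y hy => (ZFSet.mem_sep.1 hy).2,
          (ZFSet.card_mono fun y hy => (ZFSet.mem_sep.1 hy).1).trans_lt (hG _)⟩
    refine ⟨ZFSet.iUnion stage, ⟨iUnion_mem_smallSubsets hκ (by simpa) hstage,
      fun a ha y hy hyX => ?_⟩, ZFSet.subset_iUnion stage 0⟩
    obtain ⟨n, hn⟩ := ZFSet.mem_iUnion.1 ha
    refine ZFSet.mem_iUnion.2 ⟨n + 1, ?_⟩
    simp only [Function.iterate_succ_apply', step, ZFSet.mem_union, ZFSet.mem_iUnion]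
    exact Or.inr ⟨⟨a, hn⟩, ZFSet.mem_sep.2 ⟨hy, hyX⟩⟩
  · exact sUnion_mem_smallSubsets hκ hcard fun M hM => (hD M hM).1
  · obtain ⟨M, hM, ha⟩ := ZFSet.mem_sUnion.1 ha
    exact ZFSet.mem_sUnion.2 ⟨M, hM, (hD M hM).2 a ha y hy hyX⟩

theorem lift_mk_Iio_lt {ξ : Ordinal.{u}} (h : ξ.card < κ) :
    Cardinal.lift.{u} #(Iio ξ) < Cardinal.lift.{u + 1} κ := by
  rw [Cardinal.mk_Iio_ordinal, Cardinal.lift_lift]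
  exact Cardinal.lift_lt.2 h

theorem IsStrongClub.exists_increasing (hκ : κ.IsRegular) (hC : IsStrongClub κ X C)
    {b : ZFSet.{u} → ZFSet.{u}} (hb : ∀ M ∈ smallSubsets κ X, b M ∈ X) {A : ZFSet.{u}}
    (hA : A ∈ smallSubsets κ X) :
    ∃ M : Ordinal.{u} → ZFSet.{u}, ∀ ξ < κ.ord, M ξ ∈ C ∧ A ⊆ M ξ ∧
      ∀ η < ξ, M η ⊆ M ξ ∧ b (M η) ∈ M ξ := by
  choose! next hnextC hnext using hC.1.2
  let M : Ordinal.{u} → ZFSet.{u} := WellFoundedLT.fix fun ξ M =>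
    next (A ∪ ZFSet.iUnion fun η : Iio ξ => insert (b (M η η.2)) (M η η.2))
  have hM (ξ) : M ξ = next (A ∪ ZFSet.iUnion fun η : Iio ξ => insert (b (M η)) (M η)) :=
    WellFoundedLT.fix_eq _ _
  have hsmall (ξ) (hξ : ξ < κ.ord) :
      A ∪ ZFSet.iUnion (fun η : Iio ξ => insert (b (M η)) (M η)) ∈ smallSubsets κ X := by
    induction ξ using WellFoundedLT.induction with
    | _ ξ ih =>
      refine union_mem_smallSubsets hκ.aleph0_le hA
        (iUnion_mem_smallSubsets hκ (lift_mk_Iio_lt (lt_ord.1 hξ)) fun η => ?_)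
      have hη : M η ∈ smallSubsets κ X := by
        rw [hM]
        exact hC.1.1 (hnextC _ (ih η η.2 (lt_trans η.2 hξ)))
      refine ⟨fun y hy => ?_, card_insert_lt hκ.aleph0_le hη.2⟩
      rcases ZFSet.mem_insert_iff.1 hy with rfl | hy
      · exact hb _ hη
      · exact hη.1 y hy
  refine ⟨M, fun ξ hξ => ?_⟩
  have habsorb := hM ξ ▸ hnext _ (hsmall ξ hξ)
  have hstep (η) (hη : η < ξ) : insert (b (M η)) (M η) ⊆ M ξ := fun y hy =>
    habsorb (ZFSet.mem_union.2 (.inr (ZFSet.mem_iUnion.2 ⟨⟨η, hη⟩, hy⟩)))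
  exact ⟨hM ξ ▸ hnextC _ (hsmall ξ hξ), fun y hy => habsorb (ZFSet.mem_union.2 (.inl hy)),
    fun η hη => ⟨fun y hy => hstep η hη (ZFSet.mem_insert_of_mem _ hy),
      hstep η hη (ZFSet.mem_insert _ _)⟩⟩

theorem IsStrongClub.exists_directed (hκ : κ.IsRegular) (hC : IsStrongClub κ X C)
    {θ : Cardinal.{u}} (hθ : θ.IsRegular) (hθκ : θ < κ) {b : ZFSet.{u} → ZFSet.{u}}
    (hb : ∀ M ∈ smallSubsets κ X, b M ∈ X) {A : ZFSet.{u}} (hA : A ∈ smallSubsets κ X) :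
    ∃ N ∈ C, A ⊆ N ∧ ∀ a ⊆ N, a.card < θ → ∃ M ∈ C, a ⊆ M ∧ b M ∈ N := by
  obtain ⟨M, hM⟩ := hC.exists_increasing hκ hb hA
  have hlt (ξ) (hξ : ξ < θ.ord) : ξ < κ.ord := hξ.trans (ord_lt_ord.2 hθκ)
  have hlim : IsSuccLimit θ.ord := isSuccLimit_ord hθ.aleph0_le
  have : Nonempty (Iio θ.ord) := ⟨⟨0, hlim.bot_lt⟩⟩
  refine ⟨ZFSet.iUnion fun ξ : Iio θ.ord => M ξ, ?_, fun y hy => ?_, fun a ha hcard => ?_⟩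
  · exact hC.iUnion_mem (lift_mk_Iio_lt (by rwa [card_ord])) fun ξ => (hM ξ (hlt ξ ξ.2)).1
  · exact ZFSet.mem_iUnion.2 ⟨⟨0, hlim.bot_lt⟩, (hM 0 (hlt 0 hlim.bot_lt)).2.1 hy⟩
  have hstage (y : a) : ∃ ξ < θ.ord, y.1 ∈ M ξ := by
    obtain ⟨ξ, hξ⟩ := ZFSet.mem_iUnion.1 (ha y.2)
    exact ⟨ξ, ξ.2, hξ⟩
  choose f hf hfM using hstage
  obtain ⟨ξ, hξ, hfξ⟩ : ∃ ξ < θ.ord, ∀ η ∈ Set.range f, η < ξ := by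
    refine exists_forall_lt_of_mk_lt_cof (mk_range_le.trans_lt ?_) (range_subset_iff.2 hf)
    rwa [ZFSet.cardinalMk_coe_sort, ← Ordinal.lift_cof, hθ.cof_ord, Cardinal.lift_lt]
  refine ⟨M ξ, (hM ξ (hlt ξ hξ)).1, fun y hy => ?_, ?_⟩
  · exact ((hM ξ (hlt ξ hξ)).2.2 _ (hfξ _ ⟨⟨y, hy⟩, rfl⟩)).1 (hfM ⟨y, hy⟩)
  · exact ZFSet.mem_iUnion.2 ⟨⟨succ ξ, hlim.succ_lt hξ⟩,
      ((hM _ (hlt _ (hlim.succ_lt hξ))).2.2 ξ (lt_succ ξ)).2⟩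

end StrongClub

/-! ### Guessing excludes strongly unbounded subadditive functions -/

section Colorings

variable {χ lam : Cardinal.{u}} {c : OrdPairs lam.ord → Iio χ.ord} {i j α β γ : Ordinal.{u}}

/-- `c(α, β) ≤ i`, as a relation between arbitrary ordinals which entails `α < β < lam`. -/
def ColorLE (c : OrdPairs lam.ord → Iio χ.ord) (i α β : Ordinal.{u}) : Prop :=
  ∃ (hα : α < lam.ord) (hβ : β < lam.ord) (h : α < β),
    (c ⟨(⟨α, hα⟩, ⟨β, hβ⟩), h⟩ : Ordinal.{u}) ≤ i

theorem ColorLE.mono (hij : i ≤ j) (h : ColorLE c i α β) : ColorLE c j α β :=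
  let ⟨hα, hβ, hαβ, hi⟩ := h
  ⟨hα, hβ, hαβ, hi.trans hij⟩

theorem ColorLE.left_lt (h : ColorLE c i α β) : α < lam.ord := h.1

theorem exists_colorLE (c : OrdPairs lam.ord → Iio χ.ord) (hαβ : α < β) (hβ : β < lam.ord) :
    ∃ i < χ.ord, ColorLE c i α β :=
  ⟨_, (c ⟨(⟨α, hαβ.trans hβ⟩, ⟨β, hβ⟩), hαβ⟩).2, hαβ.trans hβ, hβ, hαβ, le_rfl⟩

theorem IsSubadditive.colorLE_iff (hc : IsSubadditive c) (hαβ : α < β) (h : ColorLE c i β γ) :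
    ColorLE c i α γ ↔ ColorLE c i α β := by
  obtain ⟨hβ, hγ, hβγ, hi⟩ := h
  have hα : α < lam.ord := hαβ.trans hβ
  obtain ⟨htrans, htree⟩ := hc ⟨α, hα⟩ ⟨β, hβ⟩ ⟨γ, hγ⟩ hαβ hβγ
  constructor
  · rintro ⟨_, _, _, hle⟩
    exact ⟨hα, hβ, hαβ, le_trans (Subtype.coe_le_coe.2 htree) (max_le hle hi)⟩
  · rintro ⟨_, _, _, hle⟩
    exact ⟨hα, hγ, hαβ.trans hβγ, le_trans (Subtype.coe_le_coe.2 htrans) (max_le hle hi)⟩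

theorem IsStronglyUnbounded.exists_not_colorLE (hc : IsStronglyUnbounded c)
    {A : Set Ordinal.{u}} (hAlam : A ⊆ Iio lam.ord) (hA : ∀ γ < lam.ord, ∃ δ ∈ A, γ < δ)
    (hi : i < χ.ord) : ∃ α ∈ A, ∃ β ∈ A, α < β ∧ ¬ ColorLE c i α β := by
  by_contra! hle
  refine hc (Subtype.val ⁻¹' A) ?_ ⟨⟨i, hi⟩, ?_⟩
  · rintro ⟨⟨b, hb⟩, hbA⟩
    obtain ⟨δ, hδ, hbδ⟩ := hA b hb
    exact hbδ.not_ge (hbA (a := ⟨δ, hAlam hδ⟩) hδ)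
  · rintro _ ⟨⟨⟨α, β⟩, hαβ⟩, ⟨hα, hβ⟩, rfl⟩
    obtain ⟨_, _, _, h⟩ := hle α hα β hβ hαβ
    exact h

end Colorings

section Coding

variable {χ lam : Cardinal.{u}} {c : OrdPairs lam.ord → Iio χ.ord} {i j α β : Ordinal.{u}}

/-- The ordinal coding the pair `(j, α)`, for `j < χ`. -/
noncomputable def pairCode (χ : Cardinal.{u}) (j α : Ordinal.{u}) : Ordinal.{u} :=
  χ.ord * α + j

theorem pairCode_lt (hχ : ℵ₀ ≤ χ) (hlam : χ < lam) (hj : j < χ.ord) (hα : α < lam.ord) :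
    pairCode χ j α < lam.ord :=
  have hlam₀ := hχ.trans hlam.le
  have hχlam := ord_lt_ord.2 hlam
  isPrincipal_add_ord hlam₀ (isPrincipal_mul_ord hlam₀ hχlam hα) (hj.trans hχlam)

theorem pairCode_inj (hi : i < χ.ord) (hj : j < χ.ord)
    (h : pairCode χ i α = pairCode χ j β) : i = j ∧ α = β := by
  have hχ : χ.ord ≠ 0 := (pos_of_gt hi).ne'
  have hdiv := congrArg (· / χ.ord) h
  have hmod := congrArg (· % χ.ord) h
  simp only [pairCode, Ordinal.mul_add_div _ hχ, Ordinal.div_eq_zero_of_lt hi,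
    Ordinal.div_eq_zero_of_lt hj, add_zero, Ordinal.mul_add_mod_self, Ordinal.mod_eq_of_lt hi,
    Ordinal.mod_eq_of_lt hj] at hdiv hmod
  exact ⟨hmod, hdiv⟩

theorem le_pairCode (hj : j < χ.ord) : α ≤ pairCode χ j α :=
  (Ordinal.le_mul_right α (pos_of_gt hj)).trans le_self_add

/-- The set of codes of the pairs `(j, α)` with `i ≤ j < χ` and `c(α, β) ≤ j`. All levels `j ≥ i`
are recorded because the level at which a guessing model runs into a contradiction depends on
the model. -/
noncomputable def colorCode (c : OrdPairs lam.ord → Iio χ.ord) (i β : Ordinal.{u}) :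
    ZFSet.{u} :=
  ZFSet.sep (fun y => ∃ j α, i ≤ j ∧ j < χ.ord ∧ ColorLE c j α β ∧ (pairCode χ j α).toZFSet = y)
    lam.ord.toZFSet

theorem colorCode_subset : colorCode c i β ⊆ lam.ord.toZFSet :=
  fun _ hy => (ZFSet.mem_sep.1 hy).1

theorem pairCode_mem_colorCode (hχ : ℵ₀ ≤ χ) (hlam : χ < lam) (hj : j < χ.ord) :
    (pairCode χ j α).toZFSet ∈ colorCode c i β ↔ i ≤ j ∧ ColorLE c j α β := by
  rw [colorCode, ZFSet.mem_sep]
  constructor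
  · rintro ⟨-, j', α', hij, hj', hle, hcode⟩
    obtain ⟨rfl, rfl⟩ := pairCode_inj hj' hj (toZFSet_injective hcode)
    exact ⟨hij, hle⟩
  · rintro ⟨hij, hle⟩
    exact ⟨toZFSet_mem_toZFSet_iff.2 (pairCode_lt hχ hlam hj hle.left_lt), j, α, hij, hj, hle, rfl⟩

/-- The set of ordinals `α < lam` for which `a` contains the code of `(j, α)`. -/
def codedLevel (χ lam : Cardinal.{u}) (a : ZFSet.{u}) (j : Ordinal.{u}) : Set Ordinal.{u} :=
  {α | α < lam.ord ∧ (pairCode χ j α).toZFSet ∈ a}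

end Coding

section SupBelow

variable {κ lam : Cardinal.{u}} {M : ZFSet.{u}} {α γ : Ordinal.{u}}

theorem le_supBelow (hα : α < lam.ord) (hM : α.toZFSet ∈ M) : α ≤ supBelow M lam :=
  le_csSup ⟨lam.ord, fun _ h => h.1.le⟩ ⟨hα, hM⟩

theorem exists_gt_of_lt_supBelow (h : γ < supBelow M lam) :
    ∃ α < lam.ord, α.toZFSet ∈ M ∧ γ < α := by
  by_contra! hle
  exact h.not_ge (csSup_le' fun α hα => hle α hα.1 hα.2)

theorem supBelow_lt (hcof : κ ≤ lam.ord.cof) (hM : M.card < κ) : supBelow M lam < lam.ord := by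
  obtain ⟨s, hs, hMs⟩ : ∃ s < lam.ord, ∀ α ∈ {α | α < lam.ord ∧ α.toZFSet ∈ M}, α < s := by
    refine exists_forall_lt_of_mk_lt_cof (lt_of_le_of_lt (b := #M) ?_ ?_) fun α hα => hα.1
    · exact Cardinal.mk_le_of_injective (f := fun α => ⟨α.1.toZFSet, α.2.2⟩)
        fun α β h => Subtype.ext (toZFSet_injective (congrArg Subtype.val h))
    · rw [ZFSet.cardinalMk_coe_sort, ← Ordinal.lift_cof, Cardinal.lift_lt]
      exact hM.trans_le hcof
  exact (csSup_le' fun α hα => (hMs α hα).le).trans_lt hs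

theorem mem_hereditary_of_subset_toZFSet (hM : M ⊆ lam.ord.toZFSet) :
    M ∈ hereditary (succ lam) :=
  ⟨lam.ord.toZFSet, (ZFSet.isOrdinal_toZFSet _).isTransitive, hM, by simp⟩

theorem toZFSet_mem_hereditary (hα : α < lam.ord) : α.toZFSet ∈ hereditary (succ lam) :=
  mem_hereditary_of_subset_toZFSet (Ordinal.toZFSet_subset_toZFSet_iff.2 hα.le)

end SupBelow

section Models

variable {χ κ lam : Cardinal.{u}} {c : OrdPairs lam.ord → Iio χ.ord} {M N : ZFSet.{u}}
  {i α δ : Ordinal.{u}}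

/-- Every set of at most `χ` ordinals of `N ∩ lam` has a strict upper bound in `N ∩ lam`. -/
def IsOrdinalDirected (χ lam : Cardinal.{u}) (N : ZFSet.{u}) : Prop :=
  ∀ a ⊆ N, a.card ≤ χ → ∃ s < lam.ord, s.toZFSet ∈ N ∧ ∀ α < lam.ord, α.toZFSet ∈ a → α < s

theorem IsStrongClub.cofinalIn_isOrdinalDirected (hχ : ℵ₀ ≤ χ) (hχκ : succ χ < κ)
    (hκ : κ.IsRegular) (hcof : κ ≤ lam.ord.cof) {C : Set ZFSet.{u}}
    (hC : IsStrongClub κ (hereditary (succ lam)) C) :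
    CofinalIn κ (hereditary (succ lam)) {N | N ∈ C ∧ IsOrdinalDirected χ lam N} := by
  have hlim : IsSuccLimit lam.ord :=
    isSuccLimit_ord ((hκ.aleph0_le.trans hcof).trans (cof_ord_le lam))
  have hbound {M : ZFSet.{u}} (hM : M.card < κ) : succ (supBelow M lam) < lam.ord :=
    hlim.succ_lt (supBelow_lt hcof hM)
  refine ⟨fun N hN => hC.1.1 hN.1, fun A hA => ?_⟩
  obtain ⟨N, hN, hAN, hdir⟩ := hC.exists_directed hκ (isRegular_succ hχ) hχκ
    (fun M hM => toZFSet_mem_hereditary (hbound hM.2)) hA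
  refine ⟨N, ⟨hN, fun a ha hcard => ?_⟩, hAN⟩
  obtain ⟨M, hM, haM, hbM⟩ := hdir a ha (hcard.trans_lt (lt_succ χ))
  exact ⟨_, hbound (hC.1.1 hM).2, hbM, fun α hα hαa =>
    (le_supBelow hα (haM hαa)).trans_lt (lt_succ _)⟩

/-- The closure properties of `M` that stand in for elementarity in `H(lam⁺)`. The last one
reflects, for each `a ∈ M`, the fact that a level coded in `a` is bounded in `lam` or contains a
pair of large color. -/
structure IsRich (c : OrdPairs lam.ord → Iio χ.ord) (κ : Cardinal.{u}) (M : ZFSet.{u}) :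
    Prop where
  succ_supBelow_mem : ∀ a ∈ M, a.card < κ → (succ (supBelow a lam)).toZFSet ∈ M
  pairCode_mem : ∀ α < lam.ord, α.toZFSet ∈ M → ∀ j < χ.ord, (pairCode χ j α).toZFSet ∈ M
  colorCode_mem : ∀ β < lam.ord, β.toZFSet ∈ M → ∀ i < χ.ord, colorCode c i β ∈ M
  exists_witness : ∀ a ∈ M, ∀ j < χ.ord, ∃ u < lam.ord, u.toZFSet ∈ M ∧
    ((∀ α ∈ codedLevel χ lam a j, α < u) ∨
      ∃ v, v.toZFSet ∈ M ∧ u ∈ codedLevel χ lam a j ∧ v ∈ codedLevel χ lam a j ∧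
        u < v ∧ ¬ ColorLE c j u v)

theorem IsStronglyUnbounded.exists_bound_or_not_colorLE (hc : IsStronglyUnbounded c)
    (hlim : IsSuccLimit lam.ord) {A : Set Ordinal.{u}} (hA : A ⊆ Iio lam.ord) (hi : i < χ.ord) :
    ∃ u < lam.ord, ∃ v < lam.ord,
      (∀ α ∈ A, α < u) ∨ (u ∈ A ∧ v ∈ A ∧ u < v ∧ ¬ ColorLE c i u v) := by
  by_cases hbdd : ∃ u < lam.ord, ∀ α ∈ A, α < u
  · obtain ⟨u, hu, hAu⟩ := hbdd
    exact ⟨u, hu, u, hu, .inl hAu⟩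
  · push Not at hbdd
    obtain ⟨u, hu, v, hv, huv, hcolor⟩ := hc.exists_not_colorLE hA (fun γ hγ =>
      (hbdd _ (hlim.succ_lt hγ)).imp fun δ hδ => ⟨hδ.1, succ_le_iff.1 hδ.2⟩) hi
    exact ⟨u, hA hu, v, hA hv, .inr ⟨hu, hv, huv, hcolor⟩⟩

theorem exists_isStrongClub_isRich (hχ : ℵ₀ ≤ χ) (hχκ : χ < κ) (hκ : κ.IsRegular)
    (hcof : κ ≤ lam.ord.cof) (hc : IsStronglyUnbounded c) :
    ∃ C, IsStrongClub κ (hereditary (succ lam)) C ∧ ∀ M ∈ C, IsRich c κ M := by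
  have hχlam : χ < lam := hχκ.trans_le (hcof.trans (cof_ord_le lam))
  have hlim : IsSuccLimit lam.ord := isSuccLimit_ord (hχ.trans hχlam.le)
  have hwitness (a : ZFSet.{u}) (j : Ordinal.{u}) (hj : j < χ.ord) :=
    hc.exists_bound_or_not_colorLE hlim (A := codedLevel χ lam a j) (fun _ h => h.1) hj
  choose! U hU V hV hUV using hwitness
  let F (a : ZFSet.{u}) (j : Ordinal.{u}) : ZFSet.{u} :=
    {(succ (supBelow a lam)).toZFSet, (pairCode χ j a.rank).toZFSet, colorCode c j a.rank,
      (U a j).toZFSet, (V a j).toZFSet}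
  let G (a : ZFSet.{u}) : ZFSet.{u} := ZFSet.iUnion fun j : Iio χ.ord => F a j
  have hG (a : ZFSet.{u}) : (G a).card < κ := by
    refine card_iUnion_lt hκ (lift_mk_Iio_lt (by rwa [card_ord])) fun j => ?_
    iterate 4 refine card_insert_lt hκ.aleph0_le ?_
    rw [ZFSet.card_singleton]
    exact one_lt_aleph0.trans_le hκ.aleph0_le
  refine ⟨_, isStrongClub_setOf_closed hκ (hχ.trans_lt hχκ) hG, fun M ⟨_, hclosed⟩ => ?_⟩
  have hFM {a y : ZFSet.{u}} {j : Ordinal.{u}} (ha : a ∈ M) (hj : j < χ.ord) (hy : y ∈ F a j)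
      (hyX : y ∈ hereditary (succ lam)) : y ∈ M :=
    hclosed a ha y (ZFSet.mem_iUnion.2 ⟨⟨j, hj⟩, hy⟩) hyX
  refine ⟨fun a ha hcard => ?_, fun α hα hαM j hj => ?_, fun β _ hβM i hi => ?_,
    fun a ha j hj => ?_⟩
  · exact hFM ha (isSuccLimit_ord hχ).bot_lt (by simp [F])
      (toZFSet_mem_hereditary (hlim.succ_lt (supBelow_lt hcof hcard)))
  · exact hFM hαM hj (by simp [F]) (toZFSet_mem_hereditary (pairCode_lt hχ hχlam hj hα))
  · exact hFM hβM hi (by simp [F]) (mem_hereditary_of_subset_toZFSet colorCode_subset)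
  · refine ⟨U a j, hU a j hj, hFM ha hj (by simp [F]) (toZFSet_mem_hereditary (hU a j hj)), ?_⟩
    exact (hUV a j hj).imp_right fun h =>
      ⟨V a j, hFM ha hj (by simp [F]) (toZFSet_mem_hereditary (hV a j hj)), h⟩

theorem IsRich.lt_supBelow (hχ : ℵ₀ ≤ χ) (hχlam : χ < lam) (hM : IsRich c κ M)
    (hα : α < lam.ord) (hαM : α.toZFSet ∈ M) : α < supBelow M lam := by
  have hlim : IsSuccLimit χ.ord := isSuccLimit_ord hχ
  have hone : 1 < χ.ord := by simpa using hlim.succ_lt hlim.bot_lt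
  calc α ≤ pairCode χ 0 α := le_pairCode hlim.bot_lt
    _ < pairCode χ 1 α := by simp [pairCode]
    _ ≤ supBelow M lam :=
      le_supBelow (pairCode_lt hχ hχlam hone hα) (hM.pairCode_mem α hα hαM 1 hone)

theorem exists_forall_exists_colorLE_supBelow (c : OrdPairs lam.ord → Iio χ.ord)
    (hlt : supBelow M lam < lam.ord)
    (hM : ∀ α < lam.ord, α.toZFSet ∈ M → α < supBelow M lam)
    (hcof : χ < (supBelow M lam).cof) :
    ∃ i < χ.ord, ∀ γ < supBelow M lam, ∃ β, β.toZFSet ∈ M ∧ γ < β ∧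
      ColorLE c i β (supBelow M lam) := by
  by_contra! hfail
  choose! g hg hgcolor using hfail
  obtain ⟨s, hs, hgs⟩ : ∃ s < supBelow M lam, ∀ γ ∈ g '' Iio χ.ord, γ < s := by
    refine exists_forall_lt_of_mk_lt_cof (mk_image_le.trans_lt ?_) (image_subset_iff.2 hg)
    rwa [Cardinal.mk_Iio_ordinal, card_ord, ← Ordinal.lift_cof, Cardinal.lift_lt]
  obtain ⟨β, hβ, hβM, hsβ⟩ := exists_gt_of_lt_supBelow hs
  obtain ⟨i, hi, hcolor⟩ := exists_colorLE c (hM β hβ hβM) hlt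
  exact hgcolor i hi β hβM ((hgs _ ⟨i, hi, rfl⟩).trans hsβ) hcolor

theorem IsRich.isApproximated (hχ : ℵ₀ ≤ χ) (hχlam : χ < lam) (hcof : κ ≤ lam.ord.cof)
    (hc : IsSubadditive c) (hM : IsRich c κ M) (hi : i < χ.ord)
    (hcolor : ∀ γ < supBelow M lam, ∃ β, β.toZFSet ∈ M ∧ γ < β ∧
      ColorLE c i β (supBelow M lam)) :
    IsApproximated κ M lam.ord.toZFSet (colorCode c i (supBelow M lam)) := by
  intro z hz _ hcard
  have hlim : IsSuccLimit lam.ord := isSuccLimit_ord (hχ.trans hχlam.le)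
  obtain ⟨β, hβM, hzβ, hβcolor⟩ := hcolor _ (hM.lt_supBelow hχ hχlam
    (hlim.succ_lt (supBelow_lt hcof hcard)) (hM.succ_supBelow_mem z hz hcard))
  refine ⟨_, hM.colorCode_mem β hβcolor.left_lt hβM i hi, ?_⟩
  have hagree (j α : Ordinal.{u}) (hj : j < χ.ord) (hα : α < lam.ord)
      (hαz : (pairCode χ j α).toZFSet ∈ z) :
      (pairCode χ j α).toZFSet ∈ colorCode c i (supBelow M lam) ↔
        (pairCode χ j α).toZFSet ∈ colorCode c i β := by
    have hαβ : α < β := calc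
      α ≤ pairCode χ j α := le_pairCode hj
      _ ≤ supBelow z lam := le_supBelow (pairCode_lt hχ hχlam hj hα) hαz
      _ < β := (lt_succ _).trans hzβ
    rw [pairCode_mem_colorCode hχ hχlam hj, pairCode_mem_colorCode hχ hχlam hj]
    exact and_congr_right fun hij => hc.colorLE_iff hαβ (hβcolor.mono hij)
  ext y
  simp only [ZFSet.mem_inter, and_congr_left_iff]
  refine fun hyz => ⟨fun hy => ?_, fun hy => ?_⟩ <;>
    obtain ⟨-, j, α, -, hj, hα, rfl⟩ := ZFSet.mem_sep.1 hy
  · exact (hagree j α hj hα.left_lt hyz).1 hy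
  · exact (hagree j α hj hα.left_lt hyz).2 hy

theorem IsRich.mem_codedLevel_iff (hχ : ℵ₀ ≤ χ) (hχlam : χ < lam) (hN : IsRich c κ N)
    {e : ZFSet.{u}} (he : colorCode c i δ ∩ N = e ∩ N) {j : Ordinal.{u}} (hj : j < χ.ord)
    (hα : α < lam.ord) (hαN : α.toZFSet ∈ N) :
    α ∈ codedLevel χ lam e j ↔ i ≤ j ∧ ColorLE c j α δ := by
  have hcodeN := hN.pairCode_mem α hα hαN j hj
  have hiff := ZFSet.ext_iff.1 he (pairCode χ j α).toZFSet
  simp only [ZFSet.mem_inter, hcodeN, and_true, pairCode_mem_colorCode hχ hχlam hj] at hiff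
  simp only [codedLevel, mem_ofPred_eq, hα, true_and, hiff]

/-- If `e ∈ N` guesses the code and `s ∈ N` lies above all witnesses `U j`, then `s` belongs to
some coded level `k` of `e`. So that level is not bounded by `U k`, and it contains a pair of
color greater than `k` below `δ`, contradicting subadditivity. -/
theorem IsRich.not_isGuessed (hχ : ℵ₀ ≤ χ) (hχlam : χ < lam) (hc : IsSubadditive c)
    (hN : IsRich c κ N) (hdir : IsOrdinalDirected χ lam N) (hi : i < χ.ord) (hδ : δ < lam.ord)
    (hNδ : ∀ α < lam.ord, α.toZFSet ∈ N → α < δ) : ¬ IsGuessed N (colorCode c i δ) := by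
  rintro ⟨e, heN, he⟩
  have hlevel {j α : Ordinal.{u}} (hj : j < χ.ord) (hα : α < lam.ord) (hαN : α.toZFSet ∈ N) :=
    hN.mem_codedLevel_iff hχ hχlam he hj hα hαN
  choose! U hU hUN hUe using hN.exists_witness e heN
  obtain ⟨s, hs, hsN, hUs⟩ := hdir (ZFSet.range fun j : Iio χ.ord => (U j).toZFSet)
    (fun y hy => by
      obtain ⟨j, rfl⟩ := ZFSet.mem_range.1 hy
      exact hUN j j.2)
    (by
      rw [← Cardinal.lift_le.{u + 1}]
      refine ZFSet.lift_card_range_le.trans_eq ?_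
      rw [Cardinal.mk_Iio_ordinal, card_ord, Cardinal.lift_lift])
  obtain ⟨j, hj, hsδ⟩ := exists_colorLE c (hNδ s hs hsN) hδ
  have hk : max i j < χ.ord := max_lt hi hj
  have hUlt : U (max i j) < s := hUs _ (hU _ hk) (ZFSet.mem_range.2 ⟨⟨_, hk⟩, rfl⟩)
  have hsk := (hlevel hk hs hsN).2 ⟨le_max_left _ _, hsδ.mono (le_max_right _ _)⟩
  rcases hUe _ hk with hbdd | ⟨v, hvN, hu, hv, huv, hcolor⟩
  · exact (hbdd s hsk).not_gt hUlt
  · have huδ := ((hlevel hk hu.1 (hUN _ hk)).1 hu).2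
    have hvδ := ((hlevel hk hv.1 hvN).1 hv).2
    exact hcolor ((hc.colorLE_iff huv hvδ).1 huδ)

end Models

theorem WAGP.mono {Y Y' : Set ZFSet.{u}} {μ κ θ : Cardinal.{u}} (hY : Y ⊆ Y')
    (h : WAGP Y μ κ θ) : WAGP Y' μ κ θ := fun S hS x hx =>
  ⟨fun _ hM => hM.1, fun C hC =>
    ((h S hS x hx).2 C hC).mono fun _ hM => ⟨⟨hM.1.1, hY hM.1.2.1, hM.1.2.2⟩, hM.2⟩⟩

section WAGP

variable {χ κ lam : Cardinal.{u}}

theorem not_exists_isSubadditive_isStronglyUnbounded_of_WAGP (hχ : ℵ₀ ≤ χ) (hχκ : succ χ < κ)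
    (hκ : κ.IsRegular) (hcof : κ ≤ lam.ord.cof)
    (hAGP : WAGP (largeCofinality χ κ lam) κ κ (succ lam)) :
    ¬ ∃ c : OrdPairs lam.ord → Iio χ.ord, IsSubadditive c ∧ IsStronglyUnbounded c := by
  rintro ⟨c, hsub, hunb⟩
  have hχκ' : χ < κ := (lt_succ χ).trans hχκ
  have hχlam : χ < lam := hχκ'.trans_le (hcof.trans (cof_ord_le lam))
  obtain ⟨C, hC, hrich⟩ := exists_isStrongClub_isRich hχ hχκ' hκ hcof hunb
  obtain ⟨M, ⟨hM, ⟨-, hMcof⟩, -, hguess⟩, hMC⟩ :=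
    (hAGP _ (hC.cofinalIn_isOrdinalDirected hχ hχκ hκ hcof) lam.ord.toZFSet
      (mem_hereditary_of_subset_toZFSet fun _ h => h)).2 C hC
  have hMδ (α) (hα : α < lam.ord) (hαM : α.toZFSet ∈ M) : α < supBelow M lam :=
    (hrich M hMC).lt_supBelow hχ hχlam hα hαM
  have hδ : supBelow M lam < lam.ord := supBelow_lt hcof hM.2
  obtain ⟨i, hi, hcolor⟩ := exists_forall_exists_colorLE_supBelow c hδ hMδ hMcof
  obtain ⟨N, ⟨hNC, hdir⟩, -, hNM, hguessed⟩ := hguess _ colorCode_subset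
    ((hrich M hMC).isApproximated hχ hχlam hcof hsub hi hcolor)
  exact (hrich N hNC).not_isGuessed hχ hχlam hsub hdir hi hδ
    (fun α hα hαN => hMδ α hα (hNM hαN)) hguessed

theorem not_squarePrinciple_of_WAGP (hκ : κ.IsRegular) (hκunc : succ ℵ₀ < κ)
    (hcof : κ ≤ lam.ord.cof) (hAGP : WAGP (largeCofinality ℵ₀ κ lam) κ κ (succ lam))
    (hlam : lam.IsRegular) : ¬ SquarePrinciple lam := fun hsq =>
  have hunc : ℵ₀ < lam := ((lt_succ _).trans hκunc).trans_le (hcof.trans (cof_ord_le lam))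
  not_exists_isSubadditive_isStronglyUnbounded_of_WAGP le_rfl hκunc hκ hcof hAGP
    (hsq.exists_isSubadditive_isStronglyUnbounded hlam hunc)

end WAGP

theorem mainTheorem3 (χ κ lam : Cardinal.{u}) (hχ : ℵ₀ ≤ χ) (hχκ : succ χ < κ) (hκlam : κ ≤ lam)
    (hκ : κ.IsRegular) (hcof : κ ≤ lam.ord.cof)
    (hAGP : WAGP (largeCofinality χ κ lam) κ κ (succ lam)) :
    (¬ ∃ c : OrdPairs lam.ord → Iio χ.ord, IsSubadditive c ∧ IsStronglyUnbounded c) ∧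
      (lam.IsRegular → ¬ SquarePrinciple lam) := by
  refine ⟨not_exists_isSubadditive_isStronglyUnbounded_of_WAGP hχ hχκ hκ hcof hAGP,
    not_squarePrinciple_of_WAGP hκ ((succ_le_succ hχ).trans_lt hχκ) hcof (hAGP.mono ?_)⟩
  exact fun M hM => ⟨hM.1, hχ.trans_lt hM.2⟩
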